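/- A commutative ring $R$ is called (von Neumann) regular if for every $x\in R$ there is $y\in R$ with $x^2y=x$ and $y^2x=y$; this $y$ is unique and is denoted $x^*$. Let $\mathcal C$ be the category of finitely presented regular rings (finitely presented as commutative rings with the additional unary operation $(-)^*$), a full subcategory of the category of commutative rings. Let $J$ be the smallest Grothendieck topology on $\mathcal C^{\mathrm{op}}$ for which the degenerate ring $0$ is covered by the empty cosieve and, for each $R$ in $\mathcal C$ and each $a\in R$, $R$ is covered by the cosieve generated by the two quotient maps $R\to R/(a)$ and $R\to R/(aa^*-1)$. Let $I$ be the initial regular ring and $I[x]$ the free regular ring on one generator $x$. Let $J''$ be the smallest Grothendieck topology on $\mathcal C^{\mathrm{op}}$ that contains $J$, the cosieve on $I$ generated by the maps $I\to I/(p)$ for all primes $p$, and the cosieve on $I[x]$ generated by the maps $I[x]\to I[x]/(f(x))$ for all monic polynomials $f\in\mathbb Z[X]$. Then the topos $\mathrm{Sh}(\mathcal C^{\mathrm{op}},J'')$ satisfies De Morgan's law: for every object $A$ and every subobject $U\rightarrowtail A$ one has $\neg U\vee\neg\neg U=A$ in the lattice of subobjects of $A$. Moreover: 1. $J''$ is rigid: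 every object $R$ of $\mathcal C$ has a smallest $J''$-covering cosieve, and it is the cosieve generated by the morphisms $R\to S$ with $S$ irreducible (that is, $S$ has no $J''$-covering cosieve other than the maximal one). 2. The irreducible objects are exactly the finite fields, and every finite field is an object of $\mathcal C$. 3. $\mathrm{Sh}(\mathcal C^{\mathrm{op}},J'')$ is equivalent to the functor category $[\mathcal C',\mathbf{Set}]$, where $\mathcal C'$ is the full subcategory of $\mathcal C$ whose objects are the finite fields. 4. $\mathcal C'$ satisfies the Ore condition: any two homomorphisms $F\to F_1$ and $F\to F_2$ of finite fields can be completed to a commutative square by homomorphisms $F_1\to G$ and $F_2\to G$ into a finite field $G$. -/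

import Mathlib

open CategoryTheory

/-! ## Regular rings -/

/-- A commutative ring is (von Neumann) regular if every `x` has a `y` with `x²y = x` and
`y²x = y`. -/
def IsVNRegular (R : Type*) [CommRing R] : Prop :=
  ∀ x : R, ∃ y : R, x ^ 2 * y = x ∧ y ^ 2 * x = y

/-- The element `x*` of a regular ring: the (unique) `y` with `x²y = x` and `y²x = y`. -/
noncomputable def IsVNRegular.star {R : Type*} [CommRing R] (h : IsVNRegular R) (x : R) : R :=
  (h x).choose

theorem IsVNRegular.of_surjective {R S : Type*} [CommRing R] [CommRing S]
    (h : IsVNRegular R) (f : R →+* S) (hf : Function.Surjective f) : IsVNRegular S := by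
  intro s
  obtain ⟨x, rfl⟩ := hf s
  obtain ⟨y, h1, h2⟩ := h x
  exact ⟨f y, by rw [← map_pow, ← map_mul, h1], by rw [← map_pow, ← map_mul, h2]⟩

theorem IsVNRegular.star_unique {R : Type*} [CommRing R] {x y z : R}
    (hy : x ^ 2 * y = x ∧ y ^ 2 * x = y) (hz : x ^ 2 * z = x ∧ z ^ 2 * x = z) : y = z := by
  obtain ⟨hy1, hy2⟩ := hy
  obtain ⟨hz1, hz2⟩ := hz
  have h1 : y = x * y * z := by
    linear_combination (-1 : R) * hy2 + (-y ^ 2) * hz1 + (x * z) * hy2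
  have h2 : z = x * y * z := by
    linear_combination (-1 : R) * hz2 + (-z ^ 2) * hy1 + (x * y) * hz2
  rw [h1, ← h2]

/-- Terms over the set `X` of variables in the language of rings with a unary operation `star`. -/
inductive RegTerm (X : Type) : Type
  | var (x : X) : RegTerm X
  | zero : RegTerm X
  | one : RegTerm X
  | neg (s : RegTerm X) : RegTerm X
  | add (s t : RegTerm X) : RegTerm X
  | mul (s t : RegTerm X) : RegTerm X
  | star (s : RegTerm X) : RegTerm X

namespace RegTerm

/-- The relations imposed on the generators `[t]`, one for each term `t`, of the free regular
ring: `t ↦ [t]` respects the ring operations, and `[t*]` plays the role of `[t]*`. -/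
inductive Rel (X : Type) : MvPolynomial (RegTerm X) ℤ → Prop
  | zero : Rel X (MvPolynomial.X zero)
  | one : Rel X (MvPolynomial.X one - 1)
  | neg (s : RegTerm X) : Rel X (MvPolynomial.X (neg s) + MvPolynomial.X s)
  | add (s t : RegTerm X) :
      Rel X (MvPolynomial.X (add s t) - (MvPolynomial.X s + MvPolynomial.X t))
  | mul (s t : RegTerm X) :
      Rel X (MvPolynomial.X (mul s t) - MvPolynomial.X s * MvPolynomial.X t)
  | star_left (s : RegTerm X) :
      Rel X (MvPolynomial.X s ^ 2 * MvPolynomial.X (star s) - MvPolynomial.X s)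
  | star_right (s : RegTerm X) :
      Rel X (MvPolynomial.X (star s) ^ 2 * MvPolynomial.X s - MvPolynomial.X (star s))

/-- The value of a term in a regular ring under an assignment of the variables. -/
noncomputable def eval {X : Type} {R : Type*} [CommRing R] (h : IsVNRegular R) (v : X → R) :
    RegTerm X → R
  | var x => v x
  | zero => 0
  | one => 1
  | neg s => -eval h v s
  | add s t => eval h v s + eval h v t
  | mul s t => eval h v s * eval h v t
  | star s => h.star (eval h v s)

end RegTerm

/-- The free regular ring on the set `X`. -/
abbrev FreeRegRing (X : Type) : Type :=
  MvPolynomial (RegTerm X) ℤ ⧸ Ideal.span {q | RegTerm.Rel X q}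

namespace FreeRegRing

/-- The class of a term in the free regular ring. -/
noncomputable def mk {X : Type} (t : RegTerm X) : FreeRegRing X :=
  Ideal.Quotient.mk _ (MvPolynomial.X t)

/-- The free generators. -/
noncomputable def var {X : Type} (x : X) : FreeRegRing X := mk (.var x)

theorem mk_rel {X : Type} {q : MvPolynomial (RegTerm X) ℤ} (h : RegTerm.Rel X q) :
    (Ideal.Quotient.mk (Ideal.span {q | RegTerm.Rel X q}) q : FreeRegRing X) = 0 :=
  Ideal.Quotient.eq_zero_iff_mem.2 (Ideal.subset_span h)

theorem mk_zero {X : Type} : mk (.zero : RegTerm X) = 0 := mk_rel .zero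

theorem mk_one {X : Type} : mk (.one : RegTerm X) = 1 := by
  simpa [mk, sub_eq_zero] using mk_rel (X := X) .one

theorem mk_neg {X : Type} (s : RegTerm X) : mk (.neg s) = -mk s := by
  simpa [mk, ← eq_neg_iff_add_eq_zero] using mk_rel (.neg s)

theorem mk_add {X : Type} (s t : RegTerm X) : mk (.add s t) = mk s + mk t := by
  simpa [mk, sub_eq_zero] using mk_rel (.add s t)

theorem mk_mul {X : Type} (s t : RegTerm X) : mk (.mul s t) = mk s * mk t := by
  simpa [mk, sub_eq_zero] using mk_rel (.mul s t)

theorem mk_star_left {X : Type} (s : RegTerm X) : mk s ^ 2 * mk (.star s) = mk s := by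
  simpa [mk, sub_eq_zero] using mk_rel (.star_left s)

theorem mk_star_right {X : Type} (s : RegTerm X) : mk (.star s) ^ 2 * mk s = mk (.star s) := by
  simpa [mk, sub_eq_zero] using mk_rel (.star_right s)

theorem mk_surjective {X : Type} : Function.Surjective (mk : RegTerm X → FreeRegRing X) := by
  intro a
  obtain ⟨q, rfl⟩ := Ideal.Quotient.mk_surjective a
  induction q using MvPolynomial.induction_on with
  | C n =>
    have key : ∃ t : RegTerm X, mk t = ((n : ℤ) : FreeRegRing X) := by
      induction n using Int.induction_on with
      | zero => exact ⟨.zero, by simp [mk_zero]⟩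
      | succ i ih =>
        obtain ⟨t, ht⟩ := ih
        exact ⟨.add t .one, by rw [mk_add, mk_one, ht]; push_cast; ring⟩
      | pred i ih =>
        obtain ⟨t, ht⟩ := ih
        exact ⟨.add t (.neg .one), by rw [mk_add, mk_neg, mk_one, ht]; push_cast; ring⟩
    obtain ⟨t, ht⟩ := key
    refine ⟨t, ht.trans ?_⟩
    simp
  | add p q hp hq =>
    obtain ⟨s, hs⟩ := hp
    obtain ⟨t, ht⟩ := hq
    exact ⟨.add s t, by rw [mk_add, hs, ht, map_add]⟩
  | mul_X p t hp =>
    obtain ⟨s, hs⟩ := hp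
    exact ⟨.mul s t, by rw [mk_mul, hs, map_mul]; rfl⟩

theorem isVNRegular (X : Type) : IsVNRegular (FreeRegRing X) := by
  intro a
  obtain ⟨t, rfl⟩ := mk_surjective a
  exact ⟨mk (.star t), mk_star_left t, mk_star_right t⟩

/-- The universal property of the free regular ring. -/
theorem existsUnique_lift {X : Type} {R : Type*} [CommRing R] (h : IsVNRegular R) (v : X → R) :
    ∃! f : FreeRegRing X →+* R, ∀ x, f (var x) = v x := by
  let g : MvPolynomial (RegTerm X) ℤ →+* R :=
    MvPolynomial.eval₂Hom (Int.castRingHom R) (RegTerm.eval h v)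
  have hg : ∀ t, g (MvPolynomial.X t) = RegTerm.eval h v t := fun t => by simp [g]
  have hs : ∀ x : R, x ^ 2 * h.star x = x ∧ h.star x ^ 2 * x = h.star x :=
    fun x => (h x).choose_spec
  refine ⟨Ideal.Quotient.lift _ g ?_, ?_, ?_⟩
  · intro a ha
    have : Ideal.span {q | RegTerm.Rel X q} ≤ RingHom.ker g := by
      rw [Ideal.span_le]
      intro q hq
      simp only [SetLike.mem_coe, RingHom.mem_ker]
      cases hq <;> simp [hg, RegTerm.eval, hs]
    exact this ha
  · intro x
    exact hg (.var x)
  · intro f hf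
    have key : ∀ t, f (mk t) = RegTerm.eval h v t := by
      intro t
      induction t with
      | var x => exact hf x
      | zero => simp [mk_zero, RegTerm.eval]
      | one => simp [mk_one, RegTerm.eval]
      | neg s ih => simp [mk_neg, RegTerm.eval, ih]
      | add s t ihs iht => simp [mk_add, RegTerm.eval, ihs, iht]
      | mul s t ihs iht => simp [mk_mul, RegTerm.eval, ihs, iht]
      | star s ih =>
        refine IsVNRegular.star_unique (x := f (mk s)) ⟨?_, ?_⟩ ?_
        · rw [← map_pow, ← map_mul, mk_star_left]
        · rw [← map_pow, ← map_mul, mk_star_right]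
        · rw [ih]; exact hs _
    refine RingHom.ext fun a => ?_
    obtain ⟨t, rfl⟩ := mk_surjective a
    rw [key]
    exact (hg t).symm

end FreeRegRing

/-- A ring is finitely presented as a regular ring if it is the quotient of a free regular ring on
finitely many generators by a finitely generated ideal. (The congruences of a regular ring are
those of the underlying ring, i.e. they are given by ideals.) -/
def IsFPRegular (R : Type*) [CommRing R] : Prop :=
  ∃ (n : ℕ) (f : FreeRegRing (Fin n) →+* R), Function.Surjective f ∧ (RingHom.ker f).FG

theorem IsFPRegular.isVNRegular {R : Type*} [CommRing R] (h : IsFPRegular R) :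
    IsVNRegular R := by
  obtain ⟨n, f, hf, -⟩ := h
  exact (FreeRegRing.isVNRegular _).of_surjective f hf

theorem IsFPRegular.quotient {R : Type*} [CommRing R] (h : IsFPRegular R) (a : R) :
    IsFPRegular (R ⧸ Ideal.span {a}) := by
  obtain ⟨n, f, hf, hk⟩ := h
  refine ⟨n, (Ideal.Quotient.mk _).comp f, Ideal.Quotient.mk_surjective.comp hf, ?_⟩
  refine Ideal.fg_ker_comp f _ hk ?_ hf
  rw [Ideal.mk_ker]
  exact Submodule.fg_span_singleton a

theorem FreeRegRing.isFPRegular (n : ℕ) : IsFPRegular (FreeRegRing (Fin n)) := by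
  refine ⟨n, RingHom.id _, Function.surjective_id, ?_⟩
  rw [(RingHom.injective_iff_ker_eq_bot _).1 Function.injective_id]
  exact Submodule.fg_bot

/-! ## The category of finitely presented regular rings and its topology -/

/-- The category of finitely presented regular rings, a full subcategory of the category of
commutative rings. -/
abbrev FPReg : Type 1 :=
  ObjectProperty.FullSubcategory (fun R : CommRingCat.{0} => IsFPRegular R)

namespace FPReg

/-- The free regular ring on `n` generators as an object of the category. -/
noncomputable abbrev free (n : ℕ) : FPReg :=
  ⟨CommRingCat.of (FreeRegRing (Fin n)), FreeRegRing.isFPRegular n⟩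

/-- The quotient `R/(a)` as an object of the category. -/
noncomputable abbrev quot (R : FPReg) (a : R.obj) : FPReg :=
  ⟨CommRingCat.of (R.obj ⧸ Ideal.span {a}), R.property.quotient a⟩

/-- The quotient map `R → R/(a)`. -/
noncomputable abbrev quotMap (R : FPReg) (a : R.obj) : R ⟶ R.quot a :=
  ObjectProperty.homMk (CommRingCat.ofHom (Ideal.Quotient.mk (Ideal.span {a})))

/-- The cosieve on `R` generated by the quotient maps `R → R/(a i)`, as a sieve in the opposite
category. -/
noncomputable def quotCosieve (R : FPReg) {ι : Type} (a : ι → R.obj) : Sieve (Opposite.op R) :=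
  Sieve.ofArrows (fun i => Opposite.op (R.quot (a i))) (fun i => (R.quotMap (a i)).op)

/-- The conditions on a topology on the opposite of the category of finitely presented regular
rings which express the theory of fields: the degenerate ring is covered by the empty cosieve, and
each `R` is covered by `R → R/(a)` and `R → R/(aa* - 1)`, for every `a` in `R`. -/
structure CoversFields (K : GrothendieckTopology FPRegᵒᵖ) : Prop where
  degenerate : ∀ R : FPReg, Subsingleton R.obj → (⊥ : Sieve (Opposite.op R)) ∈ K (Opposite.op R)
  zero_or_unit : ∀ (R : FPReg) (a : R.obj),
    R.quotCosieve ![a, a * R.property.isVNRegular.star a - 1] ∈ K (Opposite.op R)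

/-- The conditions expressing the two further axioms: the initial object `I` is covered by the
maps `I → I/(p)`, with `p` prime, and `I[x]` is covered by the maps `I[x] → I[x]/(f(x))`, with `f`
monic over the integers. -/
structure CoversAlgebraic (K : GrothendieckTopology FPRegᵒᵖ) : Prop where
  char_ne_zero : (free 0).quotCosieve (fun p : Nat.Primes => ((p : ℕ) : FreeRegRing (Fin 0))) ∈
    K (Opposite.op (free 0))
  algebraic : (free 1).quotCosieve
      (fun f : {f : Polynomial ℤ // f.Monic} =>
        (Polynomial.aeval (FreeRegRing.var (0 : Fin 1)) f.1 : FreeRegRing (Fin 1))) ∈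
    K (Opposite.op (free 1))

/-- The topology whose sheaves form the classifying topos of the theory of fields. -/
def fieldTopology : GrothendieckTopology FPRegᵒᵖ := sInf {K | CoversFields K}

/-- The topology generated by the topology of the theory of fields together with the cosieves
generated by the `I → I/(p)`, and by the `I[x] → I[x]/(f(x))`. -/
def algTopology : GrothendieckTopology FPRegᵒᵖ := sInf {K | fieldTopology ≤ K ∧ CoversAlgebraic K}

/-- The full subcategory of the finitely presented regular rings that are finite fields. -/
abbrev FiniteFields : Type 1 :=
  ObjectProperty.FullSubcategory (fun R : FPReg => IsField R.obj ∧ Finite R.obj)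

end FPReg

/-! ## Rigid topologies -/

/-- An object is irreducible if its only covering sieve is the maximal one. -/
def IsIrreducibleFor {C : Type*} [Category C] (J : GrothendieckTopology C) (X : C) : Prop :=
  ∀ S ∈ J X, S = ⊤

/-- The sieve on `X` generated by all morphisms to `X` from irreducible objects. -/
def irreducibleSieve {C : Type*} [Category C] (J : GrothendieckTopology C) (X : C) : Sieve X :=
  Sieve.generate (fun Y (_ : Y ⟶ X) => IsIrreducibleFor J Y)

/-- A topology is rigid if every object has a smallest covering sieve, and this is the sieve
generated by the morphisms from irreducible objects. -/
def IsRigid {C : Type*} [Category C] (J : GrothendieckTopology C) : Prop :=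
  ∀ X : C, IsLeast {S : Sieve X | S ∈ J X} (irreducibleSieve J X)

/-! ## De Morgan's law -/

/-- `b` is the pseudocomplement `¬a` of `a`: the largest element whose meet with `a` is the bottom
element. That the meet of `a` and `c` is the bottom element is expressed by saying that every
common lower bound is a bottom element. -/
def IsPseudocomplement {L : Type*} [PartialOrder L] (a b : L) : Prop :=
  ∀ c : L, c ≤ b ↔ ∀ d : L, d ≤ a → d ≤ c → IsBot d

/-- De Morgan's law in a topos: for every subobject `U` of an object `A`, the pseudocomplements
`¬U` and `¬¬U` exist in the poset of subobjects of `A`, and `¬U ∨ ¬¬U` is all of `A`. -/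
def SatisfiesDeMorgan (E : Type*) [Category E] : Prop :=
  ∀ (A : E) (U : Subobject A), ∃ N M : Subobject A,
    IsPseudocomplement U N ∧ IsPseudocomplement N M ∧ Codisjoint N M

/-! ## Finite regular rings -/

namespace IsVNRegular

variable {R S : Type*} [CommRing R] [CommRing S]

/-! Everything rests on one computation (`FPReg.mem_algTopology_iff`): a cosieve on `R` is covering
iff it contains every map from `R` to a finite field.

These cosieves form a topology containing the generators, because a finite field has prime
characteristic, is integral over `ℤ`, and has only zero and units as elements. Conversely, to see
that the maps to finite fields cover `R`, pass to `R/(p)`, then impose a monic relation on each of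
the finitely many generators in turn. The result is finite, since in a finite subring `x*` is a
power of `x`; a finite regular ring is then split along `a` and `aa* - 1` until only fields and the
zero ring remain.

Hence the finite fields are the irreducible objects and the topology is rigid. The comparison lemma
identifies sheaves with functors on finite fields, and De Morgan's law there follows from the Ore
condition, that is, from amalgamation of finite fields. -/

theorem star_spec (h : IsVNRegular R) (x : R) :
    x ^ 2 * h.star x = x ∧ h.star x ^ 2 * x = h.star x :=
  (h x).choose_spec

theorem map_star (hR : IsVNRegular R) (hS : IsVNRegular S) (f : R →+* S) (x : R) :
    f (hR.star x) = hS.star (f x) := by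
  refine star_unique (x := f x) ⟨?_, ?_⟩ (hS.star_spec _)
  · rw [← map_pow, ← map_mul, (hR.star_spec x).1]
  · rw [← map_pow, ← map_mul, (hR.star_spec x).2]

theorem of_isField (h : IsField R) : IsVNRegular R := by
  intro x
  by_cases hx : x = 0
  · exact ⟨0, by simp [hx]⟩
  · obtain ⟨y, hy⟩ := h.mul_inv_cancel hx
    exact ⟨y, by linear_combination x * hy, by linear_combination y * hy⟩

/-- A finite subring of a regular ring is closed under `star`, since `x*` is a power of `x`. -/
theorem star_mem_of_finite (h : IsVNRegular R) (A : Subring R) [Finite A] {a : R} (ha : a ∈ A) :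
    h.star a ∈ A := by
  obtain ⟨h1, h2⟩ := h.star_spec a
  set y := h.star a
  have e1 : ∀ i : ℕ, a ^ i * y ^ (i + 1) = y := by
    intro i
    induction i with
    | zero => simp
    | succ i ih =>
      linear_combination (a ^ i * y ^ i) * h2 + ih
  have e2 : ∀ i m : ℕ, a ^ (i + m + 1) * y ^ i = a ^ (m + 1) := by
    intro i m
    induction i with
    | zero => simp
    | succ i ih => linear_combination (a ^ (i + m) * y ^ i) * h1 + ih
  -- Even exponents force a gap of at least two; with a gap of one, cancelling would leave the
  -- idempotent `a * y` instead of a positive power of `a`.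
  obtain ⟨i, j, hij, heq⟩ : ∃ i j : ℕ, i < j ∧ a ^ (2 * i) = a ^ (2 * j) := by
    obtain ⟨i, j, hne, heq⟩ :=
      Finite.exists_ne_map_eq_of_infinite (fun k : ℕ => (⟨a, ha⟩ : A) ^ (2 * k))
    have heq' : a ^ (2 * i) = a ^ (2 * j) := by simpa using congrArg Subtype.val heq
    rcases lt_or_gt_of_ne hne with hlt | hlt
    · exact ⟨i, j, hlt, heq'⟩
    · exact ⟨j, i, hlt, heq'.symm⟩
  obtain ⟨m, rfl⟩ : ∃ m, j = i + m + 1 := ⟨j - i - 1, by omega⟩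
  have : y = a ^ (2 * m + 1) := by
    rw [← e1 (2 * i), heq, ← e2 (2 * i + 1) (2 * m)]
    ring_nf
  rw [this]
  exact A.pow_mem ha _

end IsVNRegular

theorem FreeRegRing.map_mem_of_star_mem {X : Type} {R : Type*} [CommRing R] (h : IsVNRegular R)
    (f : FreeRegRing X →+* R) (A : Subring R) (hv : ∀ x, f (var x) ∈ A)
    (hs : ∀ a ∈ A, h.star a ∈ A) (z : FreeRegRing X) : f z ∈ A := by
  obtain ⟨t, rfl⟩ := mk_surjective z
  induction t with
  | var x => exact hv x
  | zero => simp [mk_zero, A.zero_mem]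
  | one => simp [mk_one, A.one_mem]
  | neg s ih => rw [mk_neg, map_neg]; exact A.neg_mem ih
  | add s t ihs iht => rw [mk_add, map_add]; exact A.add_mem ihs iht
  | mul s t ihs iht => rw [mk_mul, map_mul]; exact A.mul_mem ihs iht
  | star s ih =>
    have : mk (.star s) = (isVNRegular X).star (mk s) :=
      IsVNRegular.star_unique ⟨mk_star_left s, mk_star_right s⟩ ((isVNRegular X).star_spec _)
    rw [this, (isVNRegular X).map_star h]
    exact hs _ ih

/-- A finite regular ring is finitely presented as a regular ring, by its addition and
multiplication tables. -/
theorem IsFPRegular.of_finite {R : Type*} [CommRing R] [Finite R] (h : IsVNRegular R) :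
    IsFPRegular R := by
  obtain ⟨n, ⟨e⟩⟩ := Finite.exists_equiv_fin R
  obtain ⟨f, hf, -⟩ := FreeRegRing.existsUnique_lift h e.symm
  let x : R → FreeRegRing (Fin n) := fun a => FreeRegRing.var (e a)
  have hx : ∀ a, f (x a) = a := fun a => by simp [x, hf]
  let T : Set (FreeRegRing (Fin n)) := {x 0, x 1 - 1} ∪
    (Set.range (fun q : R × R => x (q.1 + q.2) - (x q.1 + x q.2)) ∪
      Set.range (fun q : R × R => x (q.1 * q.2) - x q.1 * x q.2))
  have hT : T.Finite :=
    (Set.toFinite _).union ((Set.finite_range _).union (Set.finite_range _))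
  let I := Ideal.span T
  have hI : I ≤ RingHom.ker f := by
    refine Ideal.span_le.2 ?_
    rintro _ ((rfl | rfl) | ⟨q, rfl⟩ | ⟨q, rfl⟩) <;> simp [RingHom.mem_ker, hx]
  let π := Ideal.Quotient.mk I
  have hπ : ∀ {a b}, a - b ∈ T → π a = π b := fun hab =>
    Ideal.Quotient.eq.2 (Ideal.subset_span hab)
  let g : R →+* FreeRegRing (Fin n) ⧸ I :=
    { toFun := fun a => π (x a)
      map_zero' := Ideal.Quotient.eq_zero_iff_mem.2 (Ideal.subset_span (by simp [T]))
      map_one' := by rw [hπ (b := 1) (by simp [T]), map_one]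
      map_add' := fun a b => by
        rw [hπ (Or.inr (Or.inl ⟨(a, b), rfl⟩)), map_add]
      map_mul' := fun a b => by
        rw [hπ (Or.inr (Or.inr ⟨(a, b), rfl⟩)), map_mul] }
  have hreg : IsVNRegular (FreeRegRing (Fin n) ⧸ I) :=
    (FreeRegRing.isVNRegular _).of_surjective π Ideal.Quotient.mk_surjective
  -- The range of `g` contains the generators and is closed under `star`, so the tables leave no
  -- elements beyond those coming from `R`.
  have hg : ∀ z, π z ∈ g.range := by
    refine FreeRegRing.map_mem_of_star_mem hreg π g.range
      (fun i => ⟨e.symm i, by simp [g, x]⟩) ?_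
    rintro _ ⟨a, rfl⟩
    exact ⟨h.star a, h.map_star hreg g a⟩
  refine ⟨n, f, fun a => ⟨x a, hx a⟩, ?_⟩
  have : RingHom.ker f = I := by
    refine le_antisymm (fun z hz => ?_) hI
    obtain ⟨a, ha⟩ := hg z
    have h1 : x a - z ∈ I := Ideal.Quotient.eq.1 ha
    have h2 : f (x a - z) = 0 := hI h1
    have h3 : a = 0 := by
      rw [map_sub, hx, RingHom.mem_ker.1 hz, sub_zero] at h2
      exact h2
    rw [h3, map_zero] at ha
    exact Ideal.Quotient.eq_zero_iff_mem.1 ha.symm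
  rw [this]
  exact (Submodule.fg_def).2 ⟨T, hT, rfl⟩

/-- A regular ring of nonzero characteristic is finite if it is generated, as a regular ring, by
finitely many elements that are integral over `ℤ`. -/
theorem FreeRegRing.finite_of_isIntegral {n : ℕ} {R : Type*} [CommRing R]
    (f : FreeRegRing (Fin n) →+* R) (hf : Function.Surjective f) {p : ℕ} (hp : p ≠ 0)
    (hpR : (p : R) = 0) (hint : ∀ i, IsIntegral ℤ (f (var i))) : Finite R := by
  have h : IsVNRegular R := (isVNRegular _).of_surjective f hf
  let A := Algebra.adjoin ℤ (Set.range fun i => f (var i))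
  have hA : A.toSubmodule.FG :=
    fg_adjoin_of_finite (Set.finite_range _) (by rintro _ ⟨i, rfl⟩; exact hint i)
  have : Module.Finite ℤ A := Module.Finite.iff_fg.2 hA
  have hfin : Finite A := by
    -- A finitely generated abelian group killed by `p` is finite.
    refine Module.finite_of_fg_torsion A fun a => ⟨⟨(p : ℤ), by simpa using hp⟩, ?_⟩
    refine Subtype.ext ?_
    simp [Submonoid.smul_def, hpR]
  have : Finite A.toSubring := hfin
  have hmem : ∀ z, f z ∈ A.toSubring :=
    map_mem_of_star_mem h f A.toSubring (fun i => Algebra.subset_adjoin ⟨i, rfl⟩)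
      fun a ha => h.star_mem_of_finite A.toSubring ha
  refine Finite.of_surjective (fun a : A => (a : R)) fun r => ?_
  obtain ⟨z, rfl⟩ := hf r
  exact ⟨⟨f z, hmem z⟩, rfl⟩


/-! ## De Morgan's law in functor categories -/

theorem IsPseudocomplement.map_orderIso {L M : Type*} [PartialOrder L] [PartialOrder M]
    (e : L ≃o M) {a b : L} (h : IsPseudocomplement a b) : IsPseudocomplement (e a) (e b) := by
  intro c
  rw [← e.symm_apply_le, h (e.symm c)]
  constructor
  · intro H d hda hdc x
    have := H (e.symm d) (e.symm_apply_le.2 hda) (e.symm.monotone hdc) (e.symm x)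
    exact e.symm.le_iff_le.1 this
  · intro H d hda hdc x
    have := H (e d) (e.monotone hda) (e.le_symm_apply.1 hdc) (e x)
    exact e.le_iff_le.1 this

theorem Codisjoint.of_orderIso {L M : Type*} [PartialOrder L] [PartialOrder M] [OrderTop L]
    [OrderTop M] (e : L ≃o M) {a b : L} (h : Codisjoint a b) : Codisjoint (e a) (e b) := by
  intro x ha hb
  have := h (e.le_symm_apply.2 ha) (e.le_symm_apply.2 hb)
  rw [e.le_symm_apply, map_top] at this
  exact this

/-- De Morgan's law is invariant under equivalence of categories. -/
theorem SatisfiesDeMorgan.of_equivalence {E E' : Type*} [Category E] [Category E'] (e : E ≌ E')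
    (h : SatisfiesDeMorgan E') : SatisfiesDeMorgan E := by
  intro A U
  let φ : Subobject A ≃o Subobject (e.functor.obj A) :=
    (Subobject.lowerEquivalence (MonoOver.congr A e)).toOrderIso
  obtain ⟨N, M, h1, h2, h3⟩ := h (e.functor.obj A) (φ U)
  refine ⟨φ.symm N, φ.symm M, ?_, h2.map_orderIso φ.symm, h3.of_orderIso φ.symm⟩
  simpa using h1.map_orderIso φ.symm

universe w

namespace CategoryTheory.Subfunctor

variable {C : Type*} [Category C] {F : C ⥤ Type w}

/-- The elements no restriction of which lies in `U`. -/
def pseudocompl (U : Subfunctor F) : Subfunctor F where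
  obj c := {x | ∀ ⦃d : C⦄ (f : c ⟶ d), F.map f x ∉ U.obj d}
  map {c d} g x hx e f hf := hx (g ≫ f) (by simpa using hf)

theorem isPseudocomplement_pseudocompl (U : Subfunctor F) :
    IsPseudocomplement U U.pseudocompl := by
  intro V
  constructor
  · intro h W hWU hWV X c x hx
    exact absurd (hWU c hx) (by simpa using h c (hWV c hx) (𝟙 c))
  · intro h c x hx d f hf
    -- Comparison with `⊥`, which has no elements, makes any element of `U ⊓ V` absurd.
    have hbot := h (U ⊓ V) inf_le_left inf_le_right ⊥ d
    exact (hbot (show F.map f x ∈ (U ⊓ V).obj d from ⟨hf, V.map f hx⟩)).elim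

/-- If any two morphisms out of an object of `C` can be completed to a commutative square,
then any element either has no restriction in `U`, or all its restrictions have a further
restriction in `U`. -/
theorem codisjoint_pseudocompl (hC : GrothendieckTopology.RightOreCondition Cᵒᵖ)
    (U : Subfunctor F) : Codisjoint U.pseudocompl U.pseudocompl.pseudocompl := by
  intro V h1 h2 c x _
  by_cases hx : x ∈ U.pseudocompl.obj c
  · exact h1 c hx
  · refine h2 c fun d f hf => ?_
    obtain ⟨e, g, hg⟩ : ∃ (e : C) (g : c ⟶ e), F.map g x ∈ U.obj e := by
      by_contra hcon
      exact hx fun e g hg => hcon ⟨e, g, hg⟩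
    obtain ⟨W, a, b, hab⟩ := hC f.op g.op
    have hab' : f ≫ a.unop = g ≫ b.unop := Quiver.Hom.op_inj hab
    refine hf a.unop ?_
    have : F.map a.unop (F.map f x) = F.map b.unop (F.map g x) := by
      simpa using congrArg (fun t => F.map t x) hab'
    rw [this]
    exact U.map b.unop hg

end CategoryTheory.Subfunctor

theorem SatisfiesDeMorgan.functor {C : Type*} [Category C]
    (hC : GrothendieckTopology.RightOreCondition Cᵒᵖ) : SatisfiesDeMorgan (C ⥤ Type w) := by
  intro F U
  let φ := Subfunctor.orderIsoSubobject F
  obtain ⟨V, rfl⟩ := φ.surjective U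
  exact ⟨φ V.pseudocompl, φ V.pseudocompl.pseudocompl,
    V.isPseudocomplement_pseudocompl.map_orderIso φ,
    V.pseudocompl.isPseudocomplement_pseudocompl.map_orderIso φ,
    (V.codisjoint_pseudocompl hC).of_orderIso φ⟩


namespace FPReg

open Opposite

/-! ## The covering sieves of the algebraic topology -/

theorem quotCosieve_apply {R : FPReg} {ι : Type} (a : ι → R.obj) {T : FPRegᵒᵖ} (f : T ⟶ op R) :
    R.quotCosieve a f ↔ ∃ i, f.unop.hom.hom (a i) = 0 := by
  rw [quotCosieve, Sieve.mem_ofArrows_iff]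
  constructor
  · rintro ⟨i, g, rfl⟩
    refine ⟨i, ?_⟩
    have : (Ideal.Quotient.mk (Ideal.span {a i})) (a i) = 0 :=
      Ideal.Quotient.eq_zero_iff_mem.2 (Ideal.mem_span_singleton_self _)
    change g.unop.hom.hom (Ideal.Quotient.mk (Ideal.span {a i}) (a i)) = 0
    rw [this, map_zero]
  · rintro ⟨i, hi⟩
    let g : R.quot (a i) ⟶ T.unop := ObjectProperty.homMk (CommRingCat.ofHom
      (Ideal.Quotient.lift (Ideal.span {a i}) f.unop.hom.hom fun x hx => by
        obtain ⟨y, rfl⟩ := Ideal.mem_span_singleton'.1 hx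
        rw [map_mul, hi, mul_zero]))
    refine ⟨i, g.op, ?_⟩
    apply Quiver.Hom.unop_inj
    apply ObjectProperty.hom_ext
    apply CommRingCat.hom_ext
    exact RingHom.ext fun x => rfl

/-- A map out of `S` kills `f a` iff its composite with `f` kills `a`. This carries the covers of
`I` and `I[x]` to all objects. -/
theorem pullback_quotCosieve {R S : FPReg} (f : R ⟶ S) {ι : Type} (a : ι → R.obj) :
    (R.quotCosieve a).pullback f.op = S.quotCosieve fun i => f.hom.hom (a i) := by
  ext T g
  rw [Sieve.pullback_apply, quotCosieve_apply, quotCosieve_apply]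
  rfl

/-- The inclusion of the opposite of the category of finite fields. -/
abbrev finiteFieldsInclusion : FiniteFieldsᵒᵖ ⥤ FPRegᵒᵖ :=
  (ObjectProperty.ι (fun R : FPReg => IsField R.obj ∧ Finite R.obj)).op

theorem coverByImage_le_iff {R : FPReg} (S : Sieve (op R)) :
    Sieve.coverByImage finiteFieldsInclusion (op R) ≤ S ↔
      ∀ (F : FPReg) (f : R ⟶ F), IsField F.obj → Finite F.obj → S f.op := by
  constructor
  · intro h F f hF hF'
    exact h _ (Presieve.in_coverByImage (Y := op ⟨F, hF, hF'⟩) finiteFieldsInclusion f.op)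
  · rintro h T _ ⟨⟨F, g, k, rfl⟩⟩
    exact S.downward_closed (h _ k.unop F.unop.property.1 F.unop.property.2) g

/-- The topology in which a sieve is covering if it contains all morphisms to finite fields. -/
def finiteFieldTopology : GrothendieckTopology FPRegᵒᵖ where
  sieves X := {S | ∀ (F : FPReg) (f : X.unop ⟶ F), IsField F.obj → Finite F.obj → S f.op}
  top_mem' _ _ _ _ _ := trivial
  pullback_stable' X Y S g hS F f hF hF' := hS F (g.unop ≫ f) hF hF'
  transitive' X S hS R hR F f hF hF' := by
    have := hR (hS F f hF hF') F (𝟙 F) hF hF'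
    simpa using this

theorem coversFields_finiteFieldTopology : CoversFields finiteFieldTopology where
  degenerate R hR F f hF hF' := by
    obtain ⟨x, y, hxy⟩ := hF.exists_pair_ne
    have h01 : (0 : F.obj) = 1 := by
      rw [← map_zero f.hom.hom, ← map_one f.hom.hom]
      exact congrArg _ (Subsingleton.elim _ _)
    exact hxy (by rw [← mul_one x, ← mul_one y, ← h01, mul_zero, mul_zero])
  zero_or_unit R a F f hF hF' := by
    rw [quotCosieve_apply]
    by_cases ha : f.hom.hom a = 0
    · exact ⟨0, ha⟩
    · refine ⟨1, ?_⟩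
      have h := R.property.isVNRegular.star_spec a
      obtain ⟨b, hb⟩ := hF.mul_inv_cancel ha
      have h1 := congrArg f.hom.hom h.1
      rw [map_mul, map_pow] at h1
      change f.hom.hom (a * R.property.isVNRegular.star a - 1) = 0
      rw [map_sub, map_mul, map_one]
      -- Cancel the unit `f a`, with inverse `b`, in `(f a)² f(a*) = f a`.
      linear_combination b * h1 + (1 - f.hom.hom a * f.hom.hom (R.property.isVNRegular.star a)) * hb

theorem coversAlgebraic_finiteFieldTopology : CoversAlgebraic finiteFieldTopology where
  char_ne_zero F f hF hF' := by
    rw [quotCosieve_apply]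
    have := hF.isDomain
    obtain ⟨p, hp⟩ := CharP.exists F.obj
    exact ⟨⟨p, CharP.char_is_prime F.obj p⟩, by simp⟩
  algebraic F f hF hF' := by
    rw [quotCosieve_apply]
    obtain ⟨g, hg, hg'⟩ := Algebra.IsIntegral.isIntegral (R := ℤ) (f.hom.hom (FreeRegRing.var 0))
    refine ⟨⟨g, hg⟩, ?_⟩
    rw [← Polynomial.aeval_def] at hg'
    change f.hom.hom.toIntAlgHom _ = 0
    rw [← Polynomial.aeval_algHom_apply]
    exact hg'

theorem algTopology_le : algTopology ≤ finiteFieldTopology :=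
  sInf_le ⟨sInf_le coversFields_finiteFieldTopology, coversAlgebraic_finiteFieldTopology⟩

/-! ### Covers of arbitrary objects in the algebraic topology -/

theorem coversFields_fieldTopology : CoversFields fieldTopology where
  degenerate R hR := (GrothendieckTopology.mem_sInf _ _).2 fun _ hK => hK.degenerate R hR
  zero_or_unit R a := (GrothendieckTopology.mem_sInf _ _).2 fun _ hK => hK.zero_or_unit R a

theorem fieldTopology_le : fieldTopology ≤ algTopology := le_sInf fun _ hK => hK.1

theorem coversFields_algTopology : CoversFields algTopology where
  degenerate R hR := fieldTopology_le _ (coversFields_fieldTopology.degenerate R hR)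
  zero_or_unit R a := fieldTopology_le _ (coversFields_fieldTopology.zero_or_unit R a)

theorem coversAlgebraic_algTopology : CoversAlgebraic algTopology where
  char_ne_zero := (GrothendieckTopology.mem_sInf _ _).2 fun _ hK => hK.2.char_ne_zero
  algebraic := (GrothendieckTopology.mem_sInf _ _).2 fun _ hK => hK.2.algebraic

theorem quotCosieve_prime_mem (R : FPReg) :
    R.quotCosieve (fun p : Nat.Primes => ((p : ℕ) : R.obj)) ∈ algTopology (op R) := by
  obtain ⟨f, -, -⟩ := FreeRegRing.existsUnique_lift R.property.isVNRegular (Fin.elim0 : Fin 0 → _)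
  let g : free 0 ⟶ R := ObjectProperty.homMk (CommRingCat.ofHom f)
  have := algTopology.pullback_stable g.op coversAlgebraic_algTopology.char_ne_zero
  rw [pullback_quotCosieve] at this
  convert this with p
  exact (map_natCast f p).symm

theorem quotCosieve_monic_mem (R : FPReg) (x : R.obj) :
    R.quotCosieve (fun f : {f : Polynomial ℤ // f.Monic} => Polynomial.aeval x f.1) ∈
      algTopology (op R) := by
  obtain ⟨f, hf, -⟩ := FreeRegRing.existsUnique_lift R.property.isVNRegular (fun _ : Fin 1 => x)
  let g : free 1 ⟶ R := ObjectProperty.homMk (CommRingCat.ofHom f)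
  have := algTopology.pullback_stable g.op coversAlgebraic_algTopology.algebraic
  rw [pullback_quotCosieve] at this
  convert this with q
  change _ = f.toIntAlgHom _
  rw [← Polynomial.aeval_algHom_apply]
  congr
  exact (hf 0).symm

/-- Local character of covering: this is the reduction step for each of the inductions below. -/
theorem coverByImage_mem_of_quot {R : FPReg} {ι : Type} {a : ι → R.obj}
    (ha : R.quotCosieve a ∈ algTopology (op R))
    (h : ∀ i, Sieve.coverByImage finiteFieldsInclusion (op (R.quot (a i))) ∈
      algTopology (op (R.quot (a i)))) :
    Sieve.coverByImage finiteFieldsInclusion (op R) ∈ algTopology (op R) := by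
  refine algTopology.transitive ha _ fun T f hf => ?_
  obtain ⟨i, g, rfl⟩ := (Sieve.mem_ofArrows_iff _ _ _).1 hf
  rw [Sieve.pullback_comp]
  refine algTopology.pullback_stable g (algTopology.superset_covering ?_ (h i))
  rw [coverByImage_le_iff]
  intro F k hF hF'
  exact Presieve.in_coverByImage (Y := op ⟨F, hF, hF'⟩) finiteFieldsInclusion
    (k.op ≫ (R.quotMap (a i)).op)

theorem _root_.Ideal.Quotient.card_lt {R : Type*} [CommRing R] [Finite R] {a : R} (ha : a ≠ 0) :
    Nat.card (R ⧸ Ideal.span {a}) < Nat.card R := by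
  have hs : Function.Surjective (Ideal.Quotient.mk (Ideal.span {a})) :=
    Ideal.Quotient.mk_surjective
  refine lt_of_le_of_ne (Nat.card_le_card_of_surjective _ hs) fun h => ha ?_
  refine ((Nat.bijective_iff_surjective_and_card _).2 ⟨hs, h.symm⟩).1 ?_
  rw [map_zero]
  exact Ideal.Quotient.eq_zero_iff_mem.2 (Ideal.mem_span_singleton_self _)

/-- Induction on cardinality: a nonzero nonunit `a` makes both `R/(a)` and `R/(aa* - 1)` strictly
smaller than `R`. -/
theorem coverByImage_mem_of_finite (R : FPReg) [Finite R.obj] :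
    Sieve.coverByImage finiteFieldsInclusion (op R) ∈ algTopology (op R) := by
  induction hn : Nat.card R.obj using Nat.strong_induction_on generalizing R with
  | _ n ih =>
    subst hn
    by_cases hR : Subsingleton R.obj
    · exact algTopology.superset_covering bot_le (coversFields_algTopology.degenerate R hR)
    rw [not_subsingleton_iff_nontrivial] at hR
    by_cases hF : IsField R.obj
    · refine algTopology.covering_of_eq_top ?_
      rw [← Sieve.id_mem_iff_eq_top]
      exact Presieve.in_coverByImage (Y := op ⟨R, hF, inferInstance⟩) finiteFieldsInclusion
        (𝟙 (op R))
    obtain ⟨a, ha, hu⟩ : ∃ a : R.obj, a ≠ 0 ∧ ∀ b, a * b ≠ 1 := by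
      by_contra hcon
      push Not at hcon
      exact hF ⟨exists_pair_ne _, mul_comm, fun {a} ha => hcon a ha⟩
    refine coverByImage_mem_of_quot (coversFields_algTopology.zero_or_unit R a) fun i => ?_
    have hne : ∀ i, ![a, a * R.property.isVNRegular.star a - 1] i ≠ 0 := by
      intro i
      fin_cases i
      · exact ha
      · exact sub_ne_zero.2 (hu _)
    exact @ih _ (Ideal.Quotient.card_lt (hne i)) _
      (Finite.of_surjective _ Ideal.Quotient.mk_surjective) rfl

/-- Induction on the set `s` of generators not yet known to be integral: killing a monic polynomial
in one of them removes it from `s`, and integrality of the others survives in the quotient. -/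
theorem coverByImage_mem_of_isIntegral (R : FPReg) {n : ℕ} (f : FreeRegRing (Fin n) →+* R.obj)
    (hf : Function.Surjective f) {p : ℕ} (hp : p ≠ 0) (hpR : (p : R.obj) = 0) (s : Finset (Fin n))
    (hs : ∀ i ∉ s, IsIntegral ℤ (f (.var i))) :
    Sieve.coverByImage finiteFieldsInclusion (op R) ∈ algTopology (op R) := by
  induction s using Finset.induction_on generalizing R with
  | empty =>
    have := FreeRegRing.finite_of_isIntegral f hf hp hpR fun i => hs i (by simp)
    exact coverByImage_mem_of_finite R
  | insert j s _ ih =>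
    refine coverByImage_mem_of_quot (quotCosieve_monic_mem R (f (.var j))) fun q => ?_
    let π := Ideal.Quotient.mk (Ideal.span {Polynomial.aeval (f (.var j)) q.1})
    refine ih (R.quot _) (π.comp f) (Ideal.Quotient.mk_surjective.comp hf) ?_ fun i hi => ?_
    · change (p : R.obj ⧸ Ideal.span {Polynomial.aeval (f (.var j)) q.1}) = 0
      rw [← map_natCast π, hpR, map_zero]
    · by_cases hij : i = j
      · subst hij
        refine ⟨q.1, q.2, ?_⟩
        rw [← Polynomial.aeval_def]
        change Polynomial.aeval (π.toIntAlgHom (f (.var i))) q.1 = 0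
        refine (Polynomial.aeval_algHom_apply π.toIntAlgHom _ _).trans ?_
        exact Ideal.Quotient.eq_zero_iff_mem.2 (Ideal.mem_span_singleton_self _)
      · exact (hs i (by simp [hij, hi])).map π.toIntAlgHom

theorem coverByImage_mem (R : FPReg) :
    Sieve.coverByImage finiteFieldsInclusion (op R) ∈ algTopology (op R) := by
  refine coverByImage_mem_of_quot (quotCosieve_prime_mem R) fun p => ?_
  obtain ⟨n, f, hf, -⟩ := R.property
  let π := Ideal.Quotient.mk (Ideal.span {((p : ℕ) : R.obj)})
  refine coverByImage_mem_of_isIntegral _ (π.comp f) (Ideal.Quotient.mk_surjective.comp hf)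
    p.2.ne_zero ?_ Finset.univ (by simp)
  change ((p : ℕ) : R.obj ⧸ Ideal.span {((p : ℕ) : R.obj)}) = 0
  rw [← map_natCast π]
  exact Ideal.Quotient.eq_zero_iff_mem.2 (Ideal.mem_span_singleton_self _)

theorem mem_algTopology_iff {R : FPReg} {S : Sieve (op R)} :
    S ∈ algTopology (op R) ↔ Sieve.coverByImage finiteFieldsInclusion (op R) ≤ S :=
  ⟨fun h => (coverByImage_le_iff S).2 (algTopology_le _ h),
    fun h => algTopology.superset_covering h (coverByImage_mem R)⟩

end FPReg


namespace FPReg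

open Opposite

/-! ## Irreducible objects and rigidity -/

theorem isIrreducibleFor_of_isField (F : FPReg) (hF : IsField F.obj) (hF' : Finite F.obj) :
    IsIrreducibleFor algTopology (op F) := fun S hS => by
  rw [← Sieve.id_mem_iff_eq_top]
  exact (coverByImage_le_iff S).1 (mem_algTopology_iff.1 hS) F (𝟙 F) hF hF'

/-- An irreducible object is a retract of a finite field, hence a finite field. -/
theorem isField_and_finite_of_isIrreducibleFor {R : FPReg}
    (h : IsIrreducibleFor algTopology (op R)) : IsField R.obj ∧ Finite R.obj := by
  have hid := (Sieve.id_mem_iff_eq_top (S := Sieve.coverByImage finiteFieldsInclusion (op R))).2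
    (h _ (coverByImage_mem R))
  obtain ⟨⟨F, g, k, hgk⟩⟩ := hid
  obtain ⟨hF, hF'⟩ := F.unop.property
  let s : R.obj →+* F.unop.obj.obj := k.unop.hom.hom
  let r : F.unop.obj.obj →+* R.obj := g.unop.hom.hom
  have hrs : ∀ x, r (s x) = x := fun x =>
    congrArg (fun t : op R ⟶ op R => t.unop.hom.hom x) hgk
  have : Nontrivial F.unop.obj.obj := hF.nontrivial
  have : Nontrivial R.obj := s.domain_nontrivial
  let := hF.toField
  let e : F.unop.obj.obj ≃+* R.obj :=
    RingEquiv.ofBijective r ⟨r.injective, fun x => ⟨s x, hrs x⟩⟩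
  exact ⟨e.symm.toMulEquiv.isField hF, Finite.of_equiv _ e.toEquiv⟩

theorem irreducibleSieve_eq (R : FPReg) : irreducibleSieve algTopology (op R) =
    Sieve.coverByImage finiteFieldsInclusion (op R) := by
  refine le_antisymm ?_ ?_
  · refine (Sieve.generate_le_iff _ _).2 fun Y f hY => ?_
    obtain ⟨hF, hF'⟩ := isField_and_finite_of_isIrreducibleFor (R := Y.unop) hY
    exact Presieve.in_coverByImage (Y := op ⟨Y.unop, hF, hF'⟩) finiteFieldsInclusion f
  · refine (coverByImage_le_iff _).2 fun F f hF hF' => ?_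
    exact Sieve.le_generate (fun Y (_ : Y ⟶ op R) => IsIrreducibleFor algTopology Y) _ _
      (isIrreducibleFor_of_isField F hF hF')

theorem isRigid_algTopology : IsRigid algTopology := fun X =>
  ⟨(irreducibleSieve_eq X.unop).symm ▸ coverByImage_mem X.unop,
    fun _ hS => (irreducibleSieve_eq X.unop).trans_le (mem_algTopology_iff.1 hS)⟩

theorem isIrreducibleFor_iff (R : CommRingCat.{0}) :
    (∃ h : IsFPRegular R, IsIrreducibleFor algTopology (op (⟨R, h⟩ : FPReg))) ↔
      IsField R ∧ Finite R := by
  constructor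
  · rintro ⟨_, h⟩
    exact isField_and_finite_of_isIrreducibleFor h
  · rintro ⟨hF, hF'⟩
    exact ⟨.of_finite (.of_isField hF), isIrreducibleFor_of_isField _ hF hF'⟩

/-! ## Sheaves as functors on the category of finite fields -/

/-- Finite presentations form a small family. Smallness provides the limits in `Type 0` needed by
the comparison lemma. -/
instance : EssentiallySmall.{0} FPReg := by
  rw [essentiallySmall_iff]
  refine ⟨?_, inferInstance⟩
  let Q : (Σ n, {I : Ideal (FreeRegRing (Fin n)) // I.FG}) → FPReg := fun I =>
    ⟨CommRingCat.of (FreeRegRing (Fin I.1) ⧸ I.2.1), I.1, Ideal.Quotient.mk _,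
      Ideal.Quotient.mk_surjective, by rw [Ideal.mk_ker]; exact I.2.2⟩
  refine small_of_surjective (f := toSkeleton ∘ Q) fun A => ?_
  obtain ⟨n, f, hf, hk⟩ := ((fromSkeleton FPReg).obj A).property
  refine ⟨⟨n, RingHom.ker f, hk⟩, ?_⟩
  refine (toSkeleton_eq_iff).2 ⟨ObjectProperty.isoMk _ ?_⟩
  exact (RingHom.quotientKerEquivOfSurjective hf).toCommRingCatIso

instance : EssentiallySmall.{0} FiniteFields :=
  essentiallySmall_of_fully_faithful (ObjectProperty.ι _)

instance : finiteFieldsInclusion.IsCoverDense algTopology := ⟨fun U => coverByImage_mem U.unop⟩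

/-- The topology induced on finite fields is trivial because they are irreducible; fullness of the
inclusion brings the identity back into `S`. -/
instance : finiteFieldsInclusion.IsDenseSubsite ⊥ algTopology where
  functorPushforward_mem_iff {F S} := by
    rw [GrothendieckTopology.bot_covering]
    constructor
    · intro h
      have htop := isIrreducibleFor_of_isField F.unop.obj F.unop.property.1 F.unop.property.2 _ h
      rw [← Sieve.id_mem_iff_eq_top] at htop ⊢
      obtain ⟨T, f, g, hf, hfg⟩ := htop
      have : finiteFieldsInclusion.preimage g ≫ f = 𝟙 F :=
        finiteFieldsInclusion.map_injective (by
          rw [Functor.map_comp, Functor.map_preimage, ← hfg, CategoryTheory.Functor.map_id])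
      rw [← this]
      exact S.downward_closed hf _
    · rintro rfl
      rw [Sieve.functorPushforward_top]
      exact algTopology.top_mem _

/-- Sheaves for the algebraic topology are functors on the category of finite fields. -/
noncomputable def sheafEquivFunctor :
    Sheaf algTopology (Type 0) ≌ (FiniteFields ⥤ Type 0) :=
  haveI : ∀ X, Limits.HasLimitsOfShape (StructuredArrow X finiteFieldsInclusion.op) (Type 0) :=
    fun _ => Limits.hasLimitsOfShape_of_essentiallySmall _ _
  (Functor.IsDenseSubsite.sheafEquiv ⊥ algTopology finiteFieldsInclusion (Type 0)).symm.trans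
    ((sheafBotEquivalence _).trans (opOpEquivalence FiniteFields).congrLeft)

/-! ## Amalgamation of finite fields -/

open TensorProduct in
/-- Two extensions of a finite field embed in a common one: a residue field of their tensor
product. -/
theorem rightOreCondition_finiteFields :
    GrothendieckTopology.RightOreCondition FiniteFieldsᵒᵖ := by
  intro F F₁ F₂ f₁ f₂
  let i₁ : F.unop.obj.obj →+* F₁.unop.obj.obj := f₁.unop.hom.hom.hom
  let i₂ : F.unop.obj.obj →+* F₂.unop.obj.obj := f₂.unop.hom.hom.hom
  let := F.unop.property.1.toField
  let := i₁.toAlgebra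
  let := i₂.toAlgebra
  have := F₁.unop.property.1.nontrivial
  have := F₂.unop.property.1.nontrivial
  have := F.unop.property.2
  have := F₁.unop.property.2
  have := F₂.unop.property.2
  let T := F₁.unop.obj.obj ⊗[F.unop.obj.obj] F₂.unop.obj.obj
  have : Finite T := Module.finite_of_finite F.unop.obj.obj
  -- `T` is nonzero, being a tensor product of nonzero vector spaces over a field.
  obtain ⟨m, hm⟩ := Ideal.exists_maximal T
  have hG : IsField (T ⧸ m) := (Ideal.Quotient.maximal_ideal_iff_isField_quotient m).1 hm
  have hG' : Finite (T ⧸ m) := Finite.of_surjective _ Ideal.Quotient.mk_surjective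
  let G : FiniteFields := ⟨⟨CommRingCat.of (T ⧸ m), .of_finite (.of_isField hG)⟩, hG, hG'⟩
  let j₁ : F₁.unop.obj.obj →+* T ⧸ m :=
    (Ideal.Quotient.mk m).comp Algebra.TensorProduct.includeLeftRingHom
  let j₂ : F₂.unop.obj.obj →+* T ⧸ m :=
    (Ideal.Quotient.mk m).comp Algebra.TensorProduct.includeRight.toRingHom
  let k₁ : F₁.unop ⟶ G := ObjectProperty.homMk (ObjectProperty.homMk (CommRingCat.ofHom j₁))
  let k₂ : F₂.unop ⟶ G := ObjectProperty.homMk (ObjectProperty.homMk (CommRingCat.ofHom j₂))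
  refine ⟨op G, k₁.op, k₂.op, ?_⟩
  apply Quiver.Hom.unop_inj
  apply ObjectProperty.hom_ext
  apply ObjectProperty.hom_ext
  apply CommRingCat.hom_ext
  refine RingHom.ext fun x => ?_
  change Ideal.Quotient.mk m (i₁ x ⊗ₜ 1) = Ideal.Quotient.mk m (1 ⊗ₜ i₂ x)
  congr 1
  -- Both sides become scalar multiples by `x`, which moves across the tensor sign.
  rw [← mul_one (i₁ x), ← mul_one (i₂ x)]
  exact TensorProduct.smul_tmul x 1 1

end FPReg

theorem corollary2p2 :
    SatisfiesDeMorgan (Sheaf FPReg.algTopology (Type 0)) ∧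
    IsRigid FPReg.algTopology ∧
    (∀ R : CommRingCat.{0},
      (∃ h : IsFPRegular R, IsIrreducibleFor FPReg.algTopology (Opposite.op (⟨R, h⟩ : FPReg))) ↔
        IsField R ∧ Finite R) ∧
    Nonempty (Sheaf FPReg.algTopology (Type 0) ≌ (FPReg.FiniteFields ⥤ Type 0)) ∧
    GrothendieckTopology.RightOreCondition FPReg.FiniteFieldsᵒᵖ :=
  ⟨.of_equivalence FPReg.sheafEquivFunctor (.functor FPReg.rightOreCondition_finiteFields),
    FPReg.isRigid_algTopology, FPReg.isIrreducibleFor_iff, ⟨FPReg.sheafEquivFunctor⟩,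
    FPReg.rightOreCondition_finiteFields⟩
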